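/- Let $S_n$ be the set of permutations of $\{1,\dots,n\}$, and let $s$ be West's stack-sorting map: reading $\pi=\pi_1\cdots\pi_n$ from left to right, at each step the next input entry is pushed onto the stack if the stack is empty or its top entry is larger than that input entry; otherwise the top entry of the stack is popped to the end of the output; $s(\pi)$ is the final output. A permutation $\pi$ is $2$-stack-sortable if $s(s(\pi))$ is increasing; let $W_2(n)$ be the number of $2$-stack-sortable permutations in $S_n$. The tail length $\mathrm{tl}(\pi)$ of $\pi\in S_n$ is the smallest $\ell\ge 0$ such that $\pi_{n-\ell}\neq n-\ell$, with $\mathrm{tl}(12\cdots n)=n$. Let $B_{\ge\ell}(n)$ be the number of $2$-stack-sortable $\sigma\in S_{n+\ell}$ with $\mathrm{tl}(s(\sigma))\ge\ell$, and let $$I(w,z)=\sum_{\ell\ge0}\sum_{n\ge0}B_{\ge\ell}(n)\,w^nz^\ell ,\qquad C(z)=\sum_{n\ge0}\frac1{n+1}\binom{2n}{n}z^n .$$ Then the following hold. 1. For every $n\ge1$, $$W_2(n)=\frac{2}{(n+1)(2n+1)}\binom{3n}{n}.$$ 2. As formal power series, $$(I(w,z)-I(w,0))\,(I(w,z)-C(z))=\frac{I(w,z)-C(z)}{w}-\frac{I(w,z)-I(w,0)}{z},$$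 equivalently, the identity obtained by multiplying both sides by $wz$ holds in $\mathbb Q[[w,z]]$. 3. $I(w,0)=\sum_{n\ge0}W_2(n)w^n$. Moreover, there is a unique formal power series $U=U(w)\in\mathbb Q[[w]]$ with $U=w(1+U)^3$, and $I(w,0)=1+U-U^2$. -/

import Mathlib

namespace StackSort

/-- Run the stack-sorting procedure from a given state: the first argument is the stack (its head
is the top entry), the second is the remaining input, and the result is the sequence of entries
that are still to be annexed to the output. If the next input entry is smaller than the top of the
stack, or the stack is empty, that entry is pushed; otherwise the top entry is popped to the
output. -/
def run : List ℕ → List ℕ → List ℕ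
  | [], [] => []
  | t :: stack, [] => t :: run stack []
  | [], a :: input => run [a] input
  | t :: stack, a :: input =>
      if a < t then run (a :: t :: stack) input else t :: run stack (a :: input)
termination_by stack input => 2 * input.length + stack.length

/-- The stack-sorting map `s`. A permutation (an ordering of a finite set of positive integers) is
given in one-line notation as a list. -/
def stackSort (π : List ℕ) : List ℕ := run [] π

/-- The set `S_n` of permutations of `{1, …, n}` in one-line notation. -/
def perms (n : ℕ) : Finset (List ℕ) := (List.range' 1 n).permutations.toFinset

/-- `π` is `t`-stack-sortable: the `t`-fold iterate of `s` sends it to an increasing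
permutation. -/
def IsStackSortable (t : ℕ) (π : List ℕ) : Prop := (stackSort^[t] π).Pairwise (· < ·)

instance (t : ℕ) : DecidablePred (IsStackSortable t) :=
  fun π => inferInstanceAs (Decidable ((stackSort^[t] π).Pairwise (· < ·)))

/-- The set of `t`-stack-sortable permutations in `S_n`. -/
def sortablePerms (t n : ℕ) : Finset (List ℕ) := (perms n).filter (IsStackSortable t)

/-- `W t n` is the number of `t`-stack-sortable permutations in `S_n`. -/
def W (t n : ℕ) : ℕ := (sortablePerms t n).card

/-- The tail length of `π ∈ S_n`: the smallest `ℓ ≥ 0` with `π_{n-ℓ} ≠ n - ℓ` (positions are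
counted from `1`), and `n` if there is no such `ℓ < n`. -/
def tailLength (π : List ℕ) : ℕ :=
  Nat.find (p := fun l => l = π.length ∨ π.getD (π.length - l - 1) 0 ≠ π.length - l)
    ⟨π.length, Or.inl rfl⟩

/-- `BGe l n` is the number of 2-stack-sortable `σ ∈ S_{n+l}` such that the tail length of
`s(σ)` is at least `l`. -/
def BGe (l n : ℕ) : ℕ :=
  ((sortablePerms 2 (n + l)).filter (fun σ => l ≤ tailLength (stackSort σ))).card

/-- `G l = ∑_{n ≥ 0} BGe l n w^n`, a power series in `w`. -/
noncomputable def G (l : ℕ) : PowerSeries ℚ := PowerSeries.mk fun n => (BGe l n : ℚ)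

/-- `I(w, z) = ∑_{l ≥ 0} G_l(w) z^l`, as a power series in `z` whose coefficients are power series
in `w`. -/
noncomputable def I : PowerSeries (PowerSeries ℚ) := PowerSeries.mk G

/-- The power series `I(w, 0)` in `w`. -/
noncomputable def I0 : PowerSeries ℚ := PowerSeries.constantCoeff I

/-- The variable `w` in `ℚ⟦w⟧⟦z⟧`. -/
noncomputable def w : PowerSeries (PowerSeries ℚ) := PowerSeries.C PowerSeries.X

/-- The variable `z` in `ℚ⟦w⟧⟦z⟧`. -/
noncomputable def z : PowerSeries (PowerSeries ℚ) := PowerSeries.X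

/-- The Catalan generating function `C(z) = ∑_{n ≥ 0} C_n z^n` in `ℚ⟦w⟧⟦z⟧`. -/
noncomputable def catalanZ : PowerSeries (PowerSeries ℚ) :=
  PowerSeries.mk fun n => (catalan n : PowerSeries ℚ)

end StackSort

namespace StackSort

/-! If `m` is the maximum of `L m R`, then `s(L m R) = s(L) s(R) m`. Hence preimages of `τ m`, with
`m` above `τ`, correspond to cuts of `τ` into two pieces with a preimage of each.

A σ counted by `BGe l n` has `s(σ)` equal to some τ with `s(τ)` increasing, followed by `l` further
increasing entries. So `BGe l n` sums over such τ the fertility of τ with that tail (`BGe_eq_sum`).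
Collect these fertilities over `l` into a series in `z`. The key fact is that this series factors:
for `m` above `L` and `R`, and `R` nonempty, the series of `L m R` is the product of that of `R` and
that of `L` without its constant term (`tailSeries_append_cons`). Decomposing each τ at its maximum
and summing gives the functional equation (`I_sub_catalanZ`).

That equation determines the series order by order in `w`, `I(w, 0)` included
(`eq_of_functional_equation`). It therefore suffices to exhibit one solution, written with `U` and a
Catalan series, whose value at `z = 0` is `1 + U - U^2`. A differential equation for this value
gives a two-term recurrence for its coefficients, which the closed formula satisfies. -/

/-! ### Decomposition of the stack-sorting map at the maximum. -/

theorem run_append_singleton (S R : List ℕ) (m : ℕ) (hR : ∀ x ∈ R, x < m) :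
    run (S ++ [m]) R = run S R ++ [m] := by
  induction S, R using run.induct with
  | case1 => simp [run]
  | case2 t S ih => simp [run, ih hR]
  | case3 a R ih =>
    have ha : a < m := hR a (by simp)
    have := ih (fun x hx => hR x (by simp [hx]))
    simp only [List.nil_append, run, if_pos ha]
    simpa [run] using this
  | case4 t S a R hat ih =>
    have := ih (fun x hx => hR x (by simp [hx]))
    simp only [List.cons_append, run, if_pos hat]
    simpa using this
  | case5 t S a R hat ih =>
    have := ih hR
    simp only [List.cons_append, run, if_neg hat]
    simpa using this

/-- An entry at least as large as everything before it empties the stack when it arrives. The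
previous lemma is the dual: a bottom entry above all remaining input leaves last. -/
theorem run_append_cons (S L R : List ℕ) (m : ℕ) (hS : ∀ x ∈ S, x ≤ m) (hL : ∀ x ∈ L, x ≤ m) :
    run S (L ++ m :: R) = run S L ++ run [m] R := by
  induction S, L using run.induct with
  | case1 => simp [run]
  | case2 t S ih =>
    have ht : ¬ m < t := not_lt.2 (hS t (by simp))
    have := ih (fun x hx => hS x (by simp [hx])) hL
    simp only [List.nil_append, run, if_neg ht] at this ⊢
    simp [this]
  | case3 a L ih =>
    have := ih (by simpa using hL a (by simp)) (fun x hx => hL x (by simp [hx]))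
    simpa [run] using this
  | case4 t S a L hat ih =>
    have := ih (by
      intro x hx
      rcases List.mem_cons.1 hx with rfl | hx
      · exact hL x (by simp)
      · exact hS x hx) (fun x hx => hL x (by simp [hx]))
    simp only [List.cons_append, run, if_pos hat]
    simpa using this
  | case5 t S a L hat ih =>
    have := ih (fun x hx => hS x (by simp [hx])) hL
    simp only [List.cons_append, run, if_neg hat]
    simpa using this

theorem run_perm (S R : List ℕ) : (run S R).Perm (S ++ R) := by
  induction S, R using run.induct with
  | case1 => simp [run]
  | case2 t S ih => simpa [run] using ih
  | case3 a R ih => simpa [run] using ih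
  | case4 t S a R hat ih =>
    simp only [run, if_pos hat]
    exact ih.trans (List.perm_middle (l₁ := t :: S)).symm
  | case5 t S a R hat ih =>
    simp only [run, if_neg hat]
    exact ih.cons t

theorem stackSort_perm (π : List ℕ) : (stackSort π).Perm π := by
  simpa [stackSort] using run_perm [] π

@[simp] theorem stackSort_nil : stackSort [] = [] := by simp [stackSort, run]

/-- Entries equal to the maximum are allowed in front of the chosen occurrence. -/
theorem stackSort_append_cons (L R : List ℕ) (m : ℕ) (hL : ∀ x ∈ L, x ≤ m)
    (hR : ∀ x ∈ R, x < m) :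
    stackSort (L ++ m :: R) = stackSort L ++ stackSort R ++ [m] := by
  rw [stackSort, run_append_cons [] L R m (by simp) hL]
  have := run_append_singleton [] R m hR
  simp only [List.nil_append] at this
  simp [this, stackSort]

theorem exists_eq_append_max_cons (π : List ℕ) (h : π ≠ []) :
    ∃ L m R, π = L ++ m :: R ∧ (∀ x ∈ L, x ≤ m) ∧ ∀ x ∈ R, x < m := by
  induction π with
  | nil => exact absurd rfl h
  | cons a π ih =>
    rcases eq_or_ne π [] with rfl | hπ
    · exact ⟨[], a, [], by simp⟩
    · obtain ⟨L, m, R, rfl, hL, hR⟩ := ih hπ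
      rcases le_or_gt a m with h | h
      · exact ⟨a :: L, m, R, by simp, by simpa [h] using hL, hR⟩
      · refine ⟨[], a, L ++ m :: R, by simp, by simp, ?_⟩
        intro x hx
        rcases List.mem_append.1 hx with hx | hx
        · exact (hL x hx).trans_lt h
        · rcases List.mem_cons.1 hx with rfl | hx
          · exact h
          · exact (hR x hx).trans h

/-! ### Preimages and fertility. -/

/-- The set of preimages of `τ` under the stack-sorting map. -/
def preim (τ : List ℕ) : Finset (List ℕ) :=
  τ.permutations.toFinset.filter (fun σ => stackSort σ = τ)

theorem mem_preim {σ τ : List ℕ} : σ ∈ preim τ ↔ stackSort σ = τ := by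
  simp only [preim, Finset.mem_filter, List.mem_toFinset, List.mem_permutations,
    and_iff_right_iff_imp]
  rintro rfl
  exact (stackSort_perm σ).symm

theorem perm_of_mem_preim {σ τ : List ℕ} (h : σ ∈ preim τ) : σ.Perm τ := by
  obtain rfl := mem_preim.1 h
  exact (stackSort_perm σ).symm

@[simp] theorem preim_nil : preim [] = {[]} := by
  ext σ
  rw [Finset.mem_singleton]
  refine ⟨fun h => (perm_of_mem_preim h).eq_nil, ?_⟩
  rintro rfl
  simp [mem_preim]

/-- A preimage is `L m R` with `s(L) s(R) = τ`, so it amounts to a cut position `i = |L|` and a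
preimage of each piece. The weight `φ` allows use both for counting and for summing series. -/
theorem sum_preim_concat {M : Type*} [AddCommMonoid M] (φ : List ℕ → M) (τ : List ℕ) (m : ℕ)
    (h : ∀ x ∈ τ, x < m) :
    ∑ σ ∈ preim (τ ++ [m]), φ σ = ∑ i ∈ Finset.range (τ.length + 1),
      ∑ L ∈ preim (τ.take i), ∑ R ∈ preim (τ.drop i), φ (L ++ m :: R) := by
  simp_rw [← Finset.sum_product', Finset.sum_sigma']
  symm
  refine Finset.sum_bij (fun p _ => p.2.1 ++ m :: p.2.2) ?_ ?_ ?_ ?_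
  · rintro ⟨i, L, R⟩ hp
    simp only [Finset.mem_sigma, Finset.mem_product] at hp
    obtain ⟨-, hL, hR⟩ := hp
    have hL' : ∀ x ∈ L, x ≤ m := fun x hx =>
      (h x (List.mem_of_mem_take ((perm_of_mem_preim hL).mem_iff.1 hx))).le
    have hR' : ∀ x ∈ R, x < m := fun x hx =>
      h x (List.mem_of_mem_drop ((perm_of_mem_preim hR).mem_iff.1 hx))
    rw [mem_preim] at *
    rw [stackSort_append_cons L R m hL' hR', hL, hR, List.take_append_drop]
  · rintro ⟨i, L, R⟩ hp ⟨i', L', R'⟩ hp' heq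
    simp only [Finset.mem_sigma, Finset.mem_product, Finset.mem_range] at hp hp'
    obtain ⟨hi, hL, hR⟩ := hp
    obtain ⟨hi', hL', hR'⟩ := hp'
    have hmL : m ∉ L := fun hx =>
      (h m (List.mem_of_mem_take ((perm_of_mem_preim hL).mem_iff.1 hx))).false
    have hmL' : m ∉ L' := fun hx =>
      (h m (List.mem_of_mem_take ((perm_of_mem_preim hL').mem_iff.1 hx))).false
    have hlen := (perm_of_mem_preim hL).length_eq
    have hlen' := (perm_of_mem_preim hL').length_eq
    rw [List.length_take] at hlen hlen'
    have hidx := congrArg (List.idxOf m) heq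
    simp only [List.idxOf_append_of_notMem hmL, List.idxOf_append_of_notMem hmL',
      List.idxOf_cons_self] at hidx
    obtain ⟨h1, h2⟩ := List.append_inj heq (by simpa using hidx)
    replace h1 : L = L' := h1
    simp only [List.cons.injEq, true_and] at h2
    obtain rfl : i = i' := by
      rw [h1] at hlen; omega
    subst h1 h2
    rfl
  · intro σ hσ
    have hperm := perm_of_mem_preim hσ
    have hm : m ∈ σ := hperm.mem_iff.2 (by simp)
    obtain ⟨L, R, rfl⟩ := List.append_of_mem hm
    have hp : (L ++ R).Perm τ := by
      have h1 : (m :: (L ++ R)).Perm (m :: τ) :=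
        List.perm_middle.symm.trans (hperm.trans (List.perm_append_singleton m τ))
      exact h1.cons_inv
    have hlt : ∀ x ∈ L ++ R, x < m := fun x hx => h x (hp.mem_iff.1 hx)
    have hs := mem_preim.1 hσ
    rw [stackSort_append_cons L R m (fun x hx => (hlt x (by simp [hx])).le)
      (fun x hx => hlt x (by simp [hx]))] at hs
    have hs' := List.append_cancel_right hs
    have hlen : (stackSort L).length = L.length := (stackSort_perm L).length_eq
    refine ⟨⟨L.length, L, R⟩, ?_, rfl⟩
    simp only [Finset.mem_sigma, Finset.mem_product, Finset.mem_range, mem_preim]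
    refine ⟨?_, ?_, ?_⟩
    · have := hp.length_eq
      simp at this
      omega
    · rw [← hs', ← hlen, List.take_left]
    · rw [← hs', ← hlen, List.drop_left]
  · intro _ _
    rfl

/-- The fertility of `τ`: its number of preimages under the stack-sorting map. -/
def fert (τ : List ℕ) : ℕ := (preim τ).card

@[simp] theorem fert_nil : fert [] = 1 := by simp [fert]

theorem fert_concat (τ : List ℕ) (m : ℕ) (h : ∀ x ∈ τ, x < m) :
    fert (τ ++ [m]) = ∑ i ∈ Finset.range (τ.length + 1), fert (τ.take i) * fert (τ.drop i) := by
  have := sum_preim_concat (fun _ => 1) τ m h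
  simpa [fert] using this

/-- The output of the stack always ends with its maximum. -/
theorem fert_concat_eq_zero (τ : List ℕ) (m : ℕ) (h : ∃ x ∈ τ, m < x) : fert (τ ++ [m]) = 0 := by
  rw [fert, Finset.card_eq_zero, Finset.eq_empty_iff_forall_notMem]
  intro σ hσ
  have hperm := perm_of_mem_preim hσ
  have hne : σ ≠ [] := by
    rintro rfl
    simpa using hperm.symm.eq_nil
  obtain ⟨L, M, R, rfl, hL, hR⟩ := exists_eq_append_max_cons σ hne
  have hs := mem_preim.1 hσ
  rw [stackSort_append_cons L R M hL hR] at hs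
  obtain ⟨-, hM⟩ := List.append_inj' hs rfl
  obtain rfl : M = m := by simpa using hM
  obtain ⟨x, hx, hMx⟩ := h
  have : x ∈ L ++ M :: R := hperm.mem_iff.2 (by simp [hx])
  rcases List.mem_append.1 this with h | h
  · exact absurd (hL x h) (not_le.2 hMx)
  · rcases List.mem_cons.1 h with rfl | h
    · exact hMx.false
    · exact absurd (hR x h) (not_lt.2 hMx.le)

/-- The last entry is the maximum. The two sums separate the cuts within `τ` from those strictly
inside the increasing run. -/
theorem fert_append_range'_succ (τ : List ℕ) (N l : ℕ) (h : ∀ x ∈ τ, x < N) :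
    fert (τ ++ List.range' N (l + 1)) =
      ∑ i ∈ Finset.range (τ.length + 1),
        fert (τ.take i) * fert (τ.drop i ++ List.range' N l) +
      ∑ j ∈ Finset.range l,
        fert (τ ++ List.range' N (j + 1)) * fert (List.range' (N + (j + 1)) (l - (j + 1))) := by
  rw [List.range'_1_concat, ← List.append_assoc, fert_concat]
  · rw [List.length_append, List.length_range', show τ.length + l + 1 = (τ.length + 1) + l by ring,
      Finset.sum_range_add]
    congr 1
    · refine Finset.sum_congr rfl fun i hi => ?_
      have hi : i ≤ τ.length := by simpa [Nat.lt_succ_iff] using hi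
      rw [List.take_append_of_le_length hi, List.drop_append_of_le_length hi]
    · refine Finset.sum_congr rfl fun j hj => ?_
      have hj : j < l := by simpa using hj
      rw [add_assoc, add_comm 1 j, List.take_length_add_append, List.drop_length_add_append,
        List.drop_range', List.take_range'_of_length_ge (by omega)]
      simp
  · intro x hx
    rcases List.mem_append.1 hx with hx | hx
    · exact (h x hx).trans_le (by omega)
    · exact (List.mem_range'_1.1 hx).2

/-- Only relative order matters, and the recursion just proved does not see the values in the run.
This makes `tailFert` independent of the arbitrary bound `τ.sum + 1`. -/
theorem fert_append_range'_eq (l : ℕ) (τ : List ℕ) (N M : ℕ) (hN : ∀ x ∈ τ, x < N)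
    (hM : ∀ x ∈ τ, x < M) : fert (τ ++ List.range' N l) = fert (τ ++ List.range' M l) := by
  induction l using Nat.strong_induction_on generalizing τ N M with
  | _ l ih =>
    cases l with
    | zero => simp
    | succ l =>
      rw [fert_append_range'_succ τ N l hN, fert_append_range'_succ τ M l hM]
      congr 1
      · refine Finset.sum_congr rfl fun i _ => ?_
        rw [ih l (by omega) (τ.drop i) N M (fun x hx => hN x (List.mem_of_mem_drop hx))
          (fun x hx => hM x (List.mem_of_mem_drop hx))]
      · refine Finset.sum_congr rfl fun j hj => ?_
        have hj : j < l := by simpa using hj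
        rw [ih (j + 1) (by omega) τ N M hN hM]
        have := ih (l - (j + 1)) (by omega) [] (N + (j + 1)) (M + (j + 1)) (by simp) (by simp)
        simp only [List.nil_append] at this
        rw [this]

/-- The fertility of `τ` followed by an increasing run of `l` entries that are larger than all
entries of `τ`. -/
def tailFert (l : ℕ) (τ : List ℕ) : ℕ := fert (τ ++ List.range' (τ.sum + 1) l)

theorem fert_append_range' (l : ℕ) (τ : List ℕ) (N : ℕ) (h : ∀ x ∈ τ, x < N) :
    fert (τ ++ List.range' N l) = tailFert l τ :=
  fert_append_range'_eq l τ _ _ h fun _ hx => Nat.lt_succ_of_le (List.le_sum_of_mem hx)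

theorem fert_range' (N l : ℕ) : fert (List.range' N l) = tailFert l [] :=
  fert_append_range' l [] N (by simp)

theorem tailFert_zero (τ : List ℕ) : tailFert 0 τ = fert τ := by simp [tailFert]

theorem tailFert_succ_aux (l : ℕ) (τ : List ℕ) :
    tailFert (l + 1) τ =
      ∑ i ∈ Finset.range (τ.length + 1), tailFert 0 (τ.take i) * tailFert l (τ.drop i) +
      ∑ j ∈ Finset.range l, tailFert (j + 1) τ * tailFert (l - (j + 1)) [] := by
  have h : ∀ x ∈ τ, x < τ.sum + 1 := fun _ hx => Nat.lt_succ_of_le (List.le_sum_of_mem hx)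
  rw [tailFert, fert_append_range'_succ τ _ l h]
  congr 1
  · refine Finset.sum_congr rfl fun i _ => ?_
    rw [tailFert_zero, fert_append_range' l _ _ (fun x hx => h x (List.mem_of_mem_drop hx))]
  · refine Finset.sum_congr rfl fun j _ => ?_
    rw [fert_range', fert_append_range' _ _ _ h]

theorem tailFert_nil (l : ℕ) : tailFert l [] = catalan l := by
  induction l using Nat.strong_induction_on with
  | _ l ih =>
    cases l with
    | zero => simp [tailFert]
    | succ l =>
      rw [tailFert_succ_aux, catalan_succ', Finset.Nat.sum_antidiagonal_eq_sum_range_succ_mk,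
        Finset.sum_range_succ' _ l]
      refine (add_comm _ _).trans (congrArg₂ _ (Finset.sum_congr rfl fun j hj => ?_) ?_)
      · have hj : j < l := by simpa using hj
        rw [ih _ (by omega), ih _ (by omega)]
      · simp [ih l (by omega), ih 0 (by omega)]

theorem tailFert_succ (l : ℕ) (τ : List ℕ) :
    tailFert (l + 1) τ =
      ∑ i ∈ Finset.range (τ.length + 1), tailFert 0 (τ.take i) * tailFert l (τ.drop i) +
      ∑ j ∈ Finset.range l, tailFert (j + 1) τ * catalan (l - (j + 1)) := by
  rw [tailFert_succ_aux]
  simp only [tailFert_nil]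

theorem tailFert_concat (l : ℕ) (τ : List ℕ) (m : ℕ) (h : ∀ x ∈ τ, x < m) :
    tailFert l (τ ++ [m]) = tailFert (l + 1) τ := by
  rw [← fert_append_range' l (τ ++ [m]) (m + 1), ← fert_append_range' (l + 1) τ m h,
    List.range'_succ]
  · simp
  · intro x hx
    rcases List.mem_append.1 hx with hx | hx
    · exact (h x hx).trans (by omega)
    · simp at hx; omega

theorem tailFert_zero_append_cons (L R : List ℕ) (m : ℕ) (hR : ∀ x ∈ R, x < m) (hne : R ≠ []) :
    tailFert 0 (L ++ m :: R) = 0 := by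
  rw [tailFert_zero, ← List.dropLast_append_getLast hne]
  rw [← List.cons_append, ← List.append_assoc]
  apply fert_concat_eq_zero
  exact ⟨m, by simp, hR _ (List.getLast_mem hne)⟩

open PowerSeries

/-! ### Tail series of a permutation and their factorization. -/

/-- The generating function of the numbers `tailFert l τ`. -/
noncomputable def tailSeries (τ : List ℕ) : PowerSeries ℚ := mk fun l => (tailFert l τ : ℚ)

/-- The generating function of the numbers `tailFert (l + 1) τ`. -/
noncomputable def shiftSeries (τ : List ℕ) : PowerSeries ℚ := mk fun l => (tailFert (l + 1) τ : ℚ)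

/-- The generating function of the Catalan numbers. -/
noncomputable def catalanQ : PowerSeries ℚ := mk fun n => (catalan n : ℚ)

theorem tailSeries_nil : tailSeries [] = catalanQ := by
  ext l
  simp [tailSeries, catalanQ, tailFert_nil]

theorem tailSeries_eq (τ : List ℕ) :
    tailSeries τ = C (tailFert 0 τ : ℚ) + X * shiftSeries τ := by
  ext l
  cases l with
  | zero => simp [tailSeries]
  | succ l =>
    rw [map_add, coeff_C, if_neg l.succ_ne_zero, coeff_succ_X_mul, zero_add]
    simp [tailSeries, shiftSeries]

theorem tailSeries_concat (τ : List ℕ) (m : ℕ) (h : ∀ x ∈ τ, x < m) :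
    tailSeries (τ ++ [m]) = shiftSeries τ := by
  ext l
  simp [tailSeries, shiftSeries, tailFert_concat l τ m h]

theorem shiftSeries_eq (τ : List ℕ) :
    shiftSeries τ = ∑ i ∈ Finset.range (τ.length + 1),
      C (tailFert 0 (τ.take i) : ℚ) * tailSeries (τ.drop i) + X * (shiftSeries τ * catalanQ) := by
  ext l
  rw [shiftSeries, coeff_mk, tailFert_succ]
  push_cast
  rw [map_add, map_sum]
  congr 1
  · simp only [coeff_C_mul, tailSeries, coeff_mk]
  · cases l with
    | zero => simp
    | succ l =>
      rw [coeff_succ_X_mul, coeff_mul, Finset.Nat.sum_antidiagonal_eq_sum_range_succ_mk]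
      simp [catalanQ]

/-- Both sides satisfy the same linear recursion coming from `shiftSeries_eq`: multiply the
recursion for `L` by `tailSeries R` and compare with that for `L m R`. Induction on `|L|` handles
the proper suffixes of `L`. -/
theorem shiftSeries_append_cons (L R : List ℕ) (m : ℕ) (hL : ∀ x ∈ L, x < m)
    (hR : ∀ x ∈ R, x < m) (hne : R ≠ []) :
    shiftSeries (L ++ m :: R) = shiftSeries L * tailSeries R := by
  induction hn : L.length using Nat.strong_induction_on generalizing L with
  | _ n ih =>
    subst hn
    have h1 := shiftSeries_eq (L ++ m :: R)
    have h2 := shiftSeries_eq L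
    have hsplit : ∑ i ∈ Finset.range ((L ++ m :: R).length + 1),
        C (tailFert 0 ((L ++ m :: R).take i) : ℚ) * tailSeries ((L ++ m :: R).drop i)
        = ∑ i ∈ Finset.range (L.length + 1), C (tailFert 0 (L.take i) : ℚ) *
            (X * shiftSeries (L.drop i ++ m :: R)) + C (tailFert 1 L : ℚ) * tailSeries R := by
      rw [List.length_append, List.length_cons,
        show L.length + (R.length + 1) + 1 = (L.length + 1) + (R.length + 1) by ring,
        Finset.sum_range_add, Finset.sum_range_succ' _ R.length]
      -- A prefix reaching past `m` into `R` does not end with its maximum, so its fertility is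
      -- zero.
      have hzero : ∑ i ∈ Finset.range R.length,
          C (tailFert 0 ((L ++ m :: R).take (L.length + 1 + (i + 1))) : ℚ) *
            tailSeries ((L ++ m :: R).drop (L.length + 1 + (i + 1))) = 0 := by
        refine Finset.sum_eq_zero fun i hi => ?_
        have hi : i < R.length := by simpa using hi
        rw [show L.length + 1 + (i + 1) = L.length + (i + 1 + 1) by omega,
          List.take_length_add_append, List.take_succ_cons, tailFert_zero_append_cons]
        · simp
        · exact fun x hx => hR x (List.mem_of_mem_take hx)
        · simp [hne]
      rw [hzero, zero_add]
      congr 1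
      · refine Finset.sum_congr rfl fun i hi => ?_
        have hi : i ≤ L.length := by simpa [Nat.lt_succ_iff] using hi
        rw [List.take_append_of_le_length hi, List.drop_append_of_le_length hi,
          tailSeries_eq (L.drop i ++ m :: R), tailFert_zero_append_cons _ _ _ hR hne]
        simp
      · rw [add_zero, List.take_length_add_append, List.drop_length_add_append]
        simp [tailFert_concat 0 L m hL]
    -- The constant terms of the suffix series add up to `tailFert 1 L`, which is the weight of the
    -- cut just after `m` in `hsplit`.
    have hsplit2 : ∑ i ∈ Finset.range (L.length + 1),
        C (tailFert 0 (L.take i) : ℚ) * tailSeries (L.drop i)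
        = C (tailFert 1 L : ℚ) + ∑ i ∈ Finset.range (L.length + 1),
          C (tailFert 0 (L.take i) : ℚ) * (X * shiftSeries (L.drop i)) := by
      rw [show (tailFert 1 L : ℚ) = ∑ i ∈ Finset.range (L.length + 1),
        (tailFert 0 (L.take i) : ℚ) * (tailFert 0 (L.drop i) : ℚ) by
          rw [show 1 = 0 + 1 from rfl, tailFert_succ]; simp, map_sum, ← Finset.sum_add_distrib]
      refine Finset.sum_congr rfl fun i _ => ?_
      rw [tailSeries_eq (L.drop i), map_mul]
      ring
    have hIH : ∑ i ∈ Finset.range L.length, C (tailFert 0 (L.take (i + 1)) : ℚ) *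
          (X * shiftSeries (L.drop (i + 1) ++ m :: R))
        = (∑ i ∈ Finset.range L.length, C (tailFert 0 (L.take (i + 1)) : ℚ) *
          (X * shiftSeries (L.drop (i + 1)))) * tailSeries R := by
      rw [Finset.sum_mul]
      refine Finset.sum_congr rfl fun i hi => ?_
      have hi : i < L.length := by simpa using hi
      rw [ih (L.drop (i + 1)).length (by simp; omega) (L.drop (i + 1))
        (fun x hx => hL x (List.mem_of_mem_drop hx)) rfl]
      ring
    rw [hsplit, Finset.sum_range_succ', hIH] at h1
    rw [hsplit2, Finset.sum_range_succ'] at h2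
    simp only [List.take_zero, List.drop_zero, tailFert_zero, fert_nil, Nat.cast_one, map_one,
      one_mul] at h1 h2
    -- The unknown occurs also in the `i = 0` term and in the Catalan term; the resulting factor has
    -- constant coefficient 1 and cancels.
    have h3 : (shiftSeries (L ++ m :: R) - shiftSeries L * tailSeries R)
        * (1 - X * (1 + catalanQ)) = 0 := by
      linear_combination h1 - tailSeries R * h2
    refine sub_eq_zero.1 ((mul_eq_zero.1 h3).resolve_right fun h0 => ?_)
    simpa using congrArg constantCoeff h0

theorem tailSeries_append_cons (L R : List ℕ) (m : ℕ) (hL : ∀ x ∈ L, x < m)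
    (hR : ∀ x ∈ R, x < m) (hne : R ≠ []) :
    tailSeries (L ++ m :: R) = X * shiftSeries L * tailSeries R := by
  rw [tailSeries_eq, tailFert_zero_append_cons L R m hR hne,
    shiftSeries_append_cons L R m hL hR hne]
  simp [mul_assoc]

/-! ### Summation over permutations sorted by one pass. -/

/-- The sum of `tailSeries` over the permutations of `N, …, N + n - 1` that are sorted by one pass
of the stack. -/
noncomputable def sortSeries (N n : ℕ) : PowerSeries ℚ :=
  ∑ τ ∈ preim (List.range' N n), tailSeries τ

/-- The analogue of `sortSeries` for `shiftSeries`. -/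
noncomputable def sortShift (N n : ℕ) : PowerSeries ℚ :=
  ∑ τ ∈ preim (List.range' N n), shiftSeries τ

theorem sortSeries_eq (N n : ℕ) :
    sortSeries N n = C (constantCoeff (sortSeries N n)) + X * sortShift N n := by
  simp only [sortSeries, sortShift, map_sum, Finset.mul_sum, ← Finset.sum_add_distrib]
  refine Finset.sum_congr rfl fun τ _ => ?_
  conv_lhs => rw [tailSeries_eq]
  simp [tailSeries_eq]

theorem sortSeries_zero (N : ℕ) : sortSeries N 0 = catalanQ := by
  simp [sortSeries, tailSeries_nil]

/-- Each τ splits at its maximum as `L m R`. Nonempty `R` gives a product by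
`tailSeries_append_cons`; empty `R` gives the separate last term, where `m` lengthens the tail of
`L` by one. -/
theorem sortSeries_succ_aux (N n : ℕ) :
    sortSeries N (n + 1) = ∑ i ∈ Finset.range n,
      X * sortShift N i * sortSeries (N + i) (n - i) + sortShift N n := by
  have hlt : ∀ x ∈ List.range' N n, x < N + n := fun x hx => (List.mem_range'_1.1 hx).2
  rw [sortSeries, List.range'_1_concat, sum_preim_concat _ _ _ hlt, List.length_range',
    Finset.sum_range_succ]
  congr 1
  · refine Finset.sum_congr rfl fun i hi => ?_
    have hi : i < n := by simpa using hi
    rw [List.take_range'_of_length_ge hi.le, List.drop_range', mul_one, sortShift, sortSeries,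
      Finset.mul_sum (preim (List.range' N i)), Finset.sum_mul_sum]
    refine Finset.sum_congr rfl fun L hL => Finset.sum_congr rfl fun R hR => ?_
    refine tailSeries_append_cons L R _ (fun x hx => ?_) (fun x hx => ?_) ?_
    · have := List.mem_range'_1.1 ((perm_of_mem_preim hL).mem_iff.1 hx)
      omega
    · have := List.mem_range'_1.1 ((perm_of_mem_preim hR).mem_iff.1 hx)
      omega
    · rintro rfl
      have := (perm_of_mem_preim hR).length_eq
      simp at this
      omega
  · rw [List.take_range'_of_length_le le_rfl, List.drop_eq_nil_of_le (by simp)]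
    simp only [preim_nil, Finset.sum_singleton]
    exact Finset.sum_congr rfl fun L hL => tailSeries_concat L _
      fun x hx => hlt x ((perm_of_mem_preim hL).mem_iff.1 hx)

theorem sortShift_eq_of_sortSeries_eq {N M n : ℕ} (h : sortSeries N n = sortSeries M n) :
    sortShift N n = sortShift M n := by
  have h1 := sortSeries_eq N n
  rw [h, sortSeries_eq M n] at h1
  simpa using h1.symm

theorem sortSeries_eq_sortSeries (N M n : ℕ) : sortSeries N n = sortSeries M n := by
  induction n using Nat.strong_induction_on generalizing N M with
  | _ n ih =>
    cases n with
    | zero => rw [sortSeries_zero, sortSeries_zero]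
    | succ n =>
      rw [sortSeries_succ_aux, sortSeries_succ_aux,
        sortShift_eq_of_sortSeries_eq (ih n (by omega) N M)]
      congr 1
      refine Finset.sum_congr rfl fun i hi => ?_
      have hi : i < n := by simpa using hi
      rw [sortShift_eq_of_sortSeries_eq (ih i (by omega) N M), ih (n - i) (by omega)]

/-- Suppressing the terms with `p.2 = 0` is what produces `I - catalanZ` in place of `I`: the `w^0`
part of `I` is the Catalan series. -/
theorem sortSeries_succ (n : ℕ) :
    sortSeries 1 (n + 1) = sortShift 1 n + X * ∑ p ∈ Finset.HasAntidiagonal.antidiagonal n,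
      sortShift 1 p.1 * (if p.2 = 0 then 0 else sortSeries 1 p.2) := by
  rw [sortSeries_succ_aux, Finset.Nat.sum_antidiagonal_eq_sum_range_succ_mk,
    Finset.sum_range_succ, add_comm]
  simp only [Nat.sub_self, if_true, mul_zero, add_zero]
  rw [Finset.mul_sum]
  congr 1
  refine Finset.sum_congr rfl fun i hi => ?_
  have hi : i < n := by simpa using hi
  rw [if_neg (by omega), sortSeries_eq_sortSeries (1 + i) 1, mul_assoc]

/-! ### From tail lengths to fertilities. -/

theorem stackSort_append_range' (τ : List ℕ) (N l : ℕ) (h : ∀ x ∈ τ, x < N) :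
    stackSort (τ ++ List.range' N l) = stackSort τ ++ List.range' N l := by
  induction l with
  | zero => simp
  | succ l ih =>
    rw [List.range'_1_concat, ← List.append_assoc, stackSort_append_cons _ _ _ _ (by simp), ih]
    · simp
    · intro x hx
      rcases List.mem_append.1 hx with hx | hx
      · exact ((h x hx).trans_le (by omega)).le
      · exact (List.mem_range'_1.1 hx).2.le

theorem mem_sortablePerms_two {n : ℕ} {σ : List ℕ} :
    σ ∈ sortablePerms 2 n ↔ stackSort (stackSort σ) = List.range' 1 n := by
  have hp : (stackSort (stackSort σ)).Perm σ := (stackSort_perm _).trans (stackSort_perm _)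
  simp only [sortablePerms, perms, Finset.mem_filter, List.mem_toFinset, List.mem_permutations,
    IsStackSortable, Function.iterate_succ, Function.iterate_zero, Function.comp_apply, id]
  constructor
  · rintro ⟨h1, h2⟩
    exact (hp.trans h1).eq_of_pairwise (fun a b _ _ hab hba => (hab.trans hba).false.elim) h2
      (List.pairwise_lt_range' ..)
  · intro h
    rw [h] at hp ⊢
    exact ⟨hp.symm, List.pairwise_lt_range' ..⟩

theorem le_tailLength_iff {l n : ℕ} {π : List ℕ} (hlen : π.length = n + l) :
    l ≤ tailLength π ↔ π.drop n = List.range' (n + 1) l := by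
  rw [tailLength, Nat.le_find_iff]
  constructor
  · intro h
    refine List.ext_getElem (by simp [hlen]) fun i hi hi' => ?_
    have hil : i < l := by simpa using hi'
    have := h (l - 1 - i) (by omega)
    simp only [not_or, not_not] at this
    have h2 := this.2
    rw [hlen, show n + l - (l - 1 - i) - 1 = n + i by omega,
      show n + l - (l - 1 - i) = n + 1 + i by omega,
      List.getD_eq_getElem _ _ (by omega)] at h2
    simpa using h2
  · intro h j hj
    simp only [not_or, not_not]
    refine ⟨by omega, ?_⟩
    have h2 : (π.drop n)[l - 1 - j]? = (List.range' (n + 1) l)[l - 1 - j]? := by rw [h]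
    rw [List.getElem?_drop, List.getElem?_range' (by omega)] at h2
    rw [List.getD_eq_getElem?_getD, hlen, show n + l - j - 1 = n + (l - 1 - j) by omega, h2]
    simp
    omega

theorem stackSort_eq_range'_and_le_tailLength {l n : ℕ} {π : List ℕ} :
    stackSort π = List.range' 1 (n + l) ∧ l ≤ tailLength π ↔
      ∃ τ, stackSort τ = List.range' 1 n ∧ τ ++ List.range' (n + 1) l = π := by
  have hsplit : List.range' 1 (n + l) = List.range' 1 n ++ List.range' (n + 1) l := by
    rw [add_comm n 1, List.range'_append_1]
  have hlt : ∀ τ : List ℕ, τ.Perm (List.range' 1 n) → ∀ x ∈ τ, x < n + 1 := by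
    intro τ hτ x hx
    have := List.mem_range'_1.1 (hτ.mem_iff.1 hx)
    omega
  constructor
  · rintro ⟨h1, h2⟩
    have hperm : π.Perm (List.range' 1 (n + l)) := h1 ▸ (stackSort_perm π).symm
    rw [le_tailLength_iff (by simpa using hperm.length_eq)] at h2
    have hπ : π.take n ++ List.range' (n + 1) l = π := by rw [← h2, List.take_append_drop]
    refine ⟨π.take n, ?_, hπ⟩
    have hτ : (π.take n).Perm (List.range' 1 n) := by
      rw [← hπ, hsplit] at hperm
      exact (List.perm_append_right_iff _).1 hperm
    rw [← hπ, stackSort_append_range' _ _ _ (hlt _ hτ), hsplit] at h1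
    exact List.append_cancel_right h1
  · rintro ⟨τ, hτ, rfl⟩
    have hperm : τ.Perm (List.range' 1 n) := hτ ▸ (stackSort_perm τ).symm
    have hlen : τ.length = n := by simpa using hperm.length_eq
    rw [stackSort_append_range' _ _ _ (hlt _ hperm), hτ, hsplit,
      le_tailLength_iff (n := n) (by simp [hlen])]
    exact ⟨rfl, by rw [← hlen, List.drop_left]⟩

/-- The permutations counted are partitioned by `s(σ)`, and each class is the full set of preimages
of τ with its tail attached. -/
theorem BGe_eq_sum (l n : ℕ) : BGe l n = ∑ τ ∈ preim (List.range' 1 n), tailFert l τ := by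
  have hset : (sortablePerms 2 (n + l)).filter (fun σ => l ≤ tailLength (stackSort σ)) =
      (preim (List.range' 1 n)).biUnion fun τ => preim (τ ++ List.range' (n + 1) l) := by
    ext σ
    simp only [Finset.mem_filter, mem_sortablePerms_two, Finset.mem_biUnion, mem_preim,
      stackSort_eq_range'_and_le_tailLength]
    simp only [eq_comm]
  rw [BGe, hset, Finset.card_biUnion]
  · refine Finset.sum_congr rfl fun τ hτ => fert_append_range' l τ (n + 1) fun x hx => ?_
    have := List.mem_range'_1.1 ((perm_of_mem_preim hτ).mem_iff.1 hx)
    omega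
  · intro τ _ τ' _ hne
    rw [Function.onFun, Finset.disjoint_left]
    intro σ h1 h2
    rw [mem_preim] at h1 h2
    exact hne (List.append_cancel_right (h1.symm.trans h2))

theorem BGe_zero (n : ℕ) : BGe 0 n = W 2 n := by
  simp [BGe, W]

/-! ### The functional equation. -/

theorem coeff_coeff_I (l n : ℕ) : coeff n (coeff l I) = coeff l (sortSeries 1 n) := by
  simp [I, G, BGe_eq_sum, sortSeries, tailSeries]

/-- The series `(I(w, z) - I(w, 0)) / z`. -/
noncomputable def shiftI : PowerSeries (PowerSeries ℚ) := mk fun l => G (l + 1)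

theorem coeff_coeff_shiftI (l n : ℕ) : coeff n (coeff l shiftI) = coeff l (sortShift 1 n) := by
  simp [shiftI, G, BGe_eq_sum, sortShift, shiftSeries]

theorem I_sub_I0 : I - C I0 = z * shiftI := by
  ext l : 1
  cases l with
  | zero => simp [I0, z]
  | succ l =>
    rw [z, coeff_succ_X_mul, map_sub, coeff_C, if_neg l.succ_ne_zero, sub_zero]
    simp [I, shiftI]

theorem coeff_coeff_catalanZ (l n : ℕ) :
    coeff n (coeff l catalanZ) = if n = 0 then coeff l catalanQ else 0 := by
  rw [catalanZ, coeff_mk, ← map_natCast (C (R := ℚ)), coeff_C]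
  simp [catalanQ]

theorem coeff_coeff_I_sub_catalanZ (l n : ℕ) : coeff n (coeff l (I - catalanZ)) =
    coeff l (if n = 0 then 0 else sortSeries 1 n) := by
  rw [map_sub, map_sub, coeff_coeff_I, coeff_coeff_catalanZ]
  split_ifs with h
  · subst h
    simp [sortSeries_zero]
  · simp

theorem coeff_coeff_mul {A B : PowerSeries (PowerSeries ℚ)} {a b : ℕ → PowerSeries ℚ}
    (hA : ∀ l n, coeff n (coeff l A) = coeff l (a n))
    (hB : ∀ l n, coeff n (coeff l B) = coeff l (b n)) (l n : ℕ) :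
    coeff n (coeff l (A * B)) = coeff l (∑ p ∈ Finset.HasAntidiagonal.antidiagonal n, a p.1 * b p.2) := by
  simp only [coeff_mul, map_sum, hA, hB]
  exact Finset.sum_comm

/-- This is `sortSeries_succ` read coefficientwise in `w`. -/
theorem I_sub_catalanZ : I - catalanZ = w * (shiftI + z * (shiftI * (I - catalanZ))) := by
  ext l n
  rw [coeff_coeff_I_sub_catalanZ, w, coeff_C_mul]
  cases n with
  | zero => simp
  | succ n =>
    rw [if_neg n.succ_ne_zero, coeff_succ_X_mul, sortSeries_succ, map_add, map_add, map_add,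
      coeff_coeff_shiftI]
    congr 1
    cases l with
    | zero => simp [z]
    | succ l =>
      rw [z, coeff_succ_X_mul, coeff_succ_X_mul,
        coeff_coeff_mul coeff_coeff_shiftI coeff_coeff_I_sub_catalanZ]

theorem I_functional_equation :
    w * z * ((I - C I0) * (I - catalanZ)) = z * (I - catalanZ) - w * (I - C I0) := by
  rw [I_sub_I0]
  linear_combination -z * I_sub_catalanZ

/-! ### Auxiliary series: Catalan substitution and `U`. -/

theorem catalanZ_eq : catalanZ = 1 + z * catalanZ ^ 2 := by
  have h := congrArg (PowerSeries.map (Nat.castRingHom (PowerSeries ℚ)))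
    catalanSeries_sq_mul_X_add_one
  have hc : PowerSeries.map (Nat.castRingHom (PowerSeries ℚ)) catalanSeries = catalanZ := by
    ext n : 1
    simp [catalanZ]
  simp only [map_add, map_mul, map_pow, hc, map_X, map_one] at h
  rw [z]
  linear_combination -h

theorem constantCoeff_catalanZ : constantCoeff catalanZ = 1 := by
  rw [← coeff_zero_eq_constantCoeff_apply]
  simp [catalanZ]

theorem subst_catalanZ_eq {x : PowerSeries (PowerSeries ℚ)} (hx : constantCoeff x = 0) :
    subst x catalanZ = 1 + x * subst x catalanZ ^ 2 := by
  have hs : HasSubst x := HasSubst.of_constantCoeff_zero' hx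
  have h := congrArg (substAlgHom hs) catalanZ_eq
  simp only [map_add, map_mul, map_pow, map_one, z, substAlgHom_X] at h
  simpa only [coe_substAlgHom] using h

theorem exists_eq_X_mul_one_add_cube : ∃ U : PowerSeries ℚ, U = X * (1 + U) ^ 3 := by
  set Q : PowerSeries ℚ := (1 + X) ^ 3 with hQ
  have hQ1 : constantCoeff Q = 1 := by simp [hQ]
  have hQi : Q⁻¹ * Q = 1 := PowerSeries.inv_mul_cancel Q (by simp [hQ1])
  have hP : IsUnit (coeff 1 (X * Q⁻¹)) := by
    rw [← zero_add 1, coeff_succ_X_mul, coeff_zero_eq_constantCoeff_apply]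
    simp [hQ1]
  have hsub : HasSubst (substInvOfIsUnit (X * Q⁻¹) hP) := HasSubst.substInvOfIsUnit _ _
  -- `U` is the compositional inverse of `X / (1 + X)^3`.
  refine ⟨substInvOfIsUnit (X * Q⁻¹) hP, ?_⟩
  have h := subst_substInvOfIsUnit_right (X * Q⁻¹) (by simp) hP
  set U := substInvOfIsUnit (X * Q⁻¹) hP
  have hQs : subst U Q = (1 + U) ^ 3 := by
    rw [← coe_substAlgHom hsub]
    simp only [hQ, map_pow, map_add, map_one]
    rw [coe_substAlgHom, subst_X hsub]
  have h2 := congrArg (subst U) hQi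
  rw [subst_mul hsub, hQs, ← coe_substAlgHom hsub, map_one, coe_substAlgHom] at h2
  rw [subst_mul hsub, subst_X hsub] at h
  linear_combination (1 + U) ^ 3 * h - U * h2

theorem eq_of_eq_X_mul_one_add_cube {U V : PowerSeries ℚ} (hU : U = X * (1 + U) ^ 3)
    (hV : V = X * (1 + V) ^ 3) : U = V := by
  have h : (U - V) * (1 - X * ((1 + U) ^ 2 + (1 + U) * (1 + V) + (1 + V) ^ 2)) = 0 := by
    linear_combination hU - hV
  refine sub_eq_zero.1 ((mul_eq_zero.1 h).resolve_right fun h0 => ?_)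
  simpa using congrArg constantCoeff h0

theorem existsUnique_eq_X_mul_one_add_cube : ∃! U : PowerSeries ℚ, U = X * (1 + U) ^ 3 := by
  obtain ⟨U, hU⟩ := exists_eq_X_mul_one_add_cube
  exact ⟨U, hU, fun V hV => eq_of_eq_X_mul_one_add_cube hV hU⟩

/-! ### Uniqueness and the explicit solution. -/

/-- The functional equation determines a series from its terms of lower order in `w`. -/
theorem X_pow_dvd_coeff_sub {A B c : PowerSeries (PowerSeries ℚ)}
    (hA : w * z * ((A - C (constantCoeff A)) * (A - c))
      = z * (A - c) - w * (A - C (constantCoeff A)))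
    (hB : w * z * ((B - C (constantCoeff B)) * (B - c))
      = z * (B - c) - w * (B - C (constantCoeff B))) (n l : ℕ) :
    X ^ n ∣ coeff l (A - B) := by
  induction n generalizing l with
  | zero => simp
  | succ n ih =>
    set D := A - B with hD
    have hE : ∀ l, X ^ n ∣ coeff l (D - C (constantCoeff D)) := by
      intro l
      rw [map_sub, coeff_C]
      split_ifs with h
      · subst h; simp
      · simpa using ih l
    have hmul : ∀ P Q : PowerSeries (PowerSeries ℚ), (∀ l, X ^ n ∣ coeff l P) →
        ∀ l, X ^ n ∣ coeff l (P * Q) := by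
      intro P Q hP l
      rw [coeff_mul]
      exact Finset.dvd_sum fun p _ => (hP p.1).mul_right _
    set T := (D - C (constantCoeff D)) * (A - c) + D * (B - C (constantCoeff B)) with hT
    have hTd : ∀ l, X ^ n ∣ coeff l T := fun l => by
      rw [hT, map_add]
      exact dvd_add (hmul _ _ hE l) (hmul _ _ ih l)
    -- Subtracting the two equations leaves every term of `D` on the right with a factor `w`, so
    -- divisibility by `w^n` improves to `w^(n+1)`.
    have key : z * D = w * ((D - C (constantCoeff D)) + z * T) := by
      rw [hT, hD]
      simp only [map_sub]
      linear_combination hB - hA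
    have hl := congrArg (coeff (l + 1)) key
    rw [z, w, coeff_succ_X_mul, coeff_C_mul, map_add, coeff_succ_X_mul] at hl
    rw [hl, pow_succ']
    exact mul_dvd_mul_left _ (dvd_add (hE _) (hTd _))

theorem eq_of_functional_equation {A B c : PowerSeries (PowerSeries ℚ)}
    (hA : w * z * ((A - C (constantCoeff A)) * (A - c))
      = z * (A - c) - w * (A - C (constantCoeff A)))
    (hB : w * z * ((B - C (constantCoeff B)) * (B - c))
      = z * (B - c) - w * (B - C (constantCoeff B))) : A = B := by
  rw [← sub_eq_zero]
  ext l n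
  exact X_pow_dvd_iff.1 (X_pow_dvd_coeff_sub hA hB (n + 1) l) n n.lt_succ_self

/-- The explicit solution of the functional equation, in terms of `U = w (1 + U) ^ 3`. -/
noncomputable def solution (U : PowerSeries ℚ) : PowerSeries (PowerSeries ℚ) :=
  1 + 2 * C U + (1 + C U) * subst (C U * (1 + C U) * (catalanZ - 1)) catalanZ *
    ((1 + C U) * (catalanZ - 1) - C U)

theorem constantCoeff_solution_arg (U : PowerSeries ℚ) :
    constantCoeff (C U * (1 + C U) * (catalanZ - 1)) = 0 := by
  simp [constantCoeff_catalanZ]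

theorem constantCoeff_solution (U : PowerSeries ℚ) :
    constantCoeff (solution U) = 1 + U - U ^ 2 := by
  have h := congrArg constantCoeff (subst_catalanZ_eq (constantCoeff_solution_arg U))
  rw [map_add, map_mul, constantCoeff_solution_arg, zero_mul, add_zero, map_one] at h
  simp only [solution, map_add, map_sub, map_mul, map_one, h, constantCoeff_catalanZ,
    constantCoeff_C, map_ofNat]
  ring

/-- Put `c = C(z)`, `w = u / (1 + u)^3` and `z = (c - 1) / c^2`. With `1 + u - u^2` for `I(w, 0)`,
the equation is quadratic in `I` with discriminant `((1 + u)(c - 1) - u)^2 (1 - 4x)`, where `x = u(1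
+ u)(c - 1)`. The root of `1 - 4x` is supplied by the Catalan series at `x`. -/
theorem solution_functional_equation {U : PowerSeries ℚ} (hU : U = X * (1 + U) ^ 3) :
    w * z * ((solution U - C (constantCoeff (solution U))) * (solution U - catalanZ))
      = z * (solution U - catalanZ) - w * (solution U - C (constantCoeff (solution U))) := by
  have hU0 : constantCoeff U = 0 := by
    rw [hU]; simp
  have hne : (1 + C U) ^ 3 * catalanZ ^ 2 ≠ 0 := by
    intro h
    have := congrArg (fun f => constantCoeff (constantCoeff f)) h
    simp [constantCoeff_catalanZ, hU0] at this
  rw [constantCoeff_solution]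
  have hw : C U = w * (1 + C U) ^ 3 := by
    conv_lhs => rw [hU]
    simp [w]
  have hc := catalanZ_eq
  have hV := subst_catalanZ_eq (constantCoeff_solution_arg U)
  apply mul_left_cancel₀ hne
  simp only [solution, map_add, map_sub, map_pow, map_one]
  generalize subst (C U * (1 + C U) * (catalanZ - 1)) catalanZ = V at *
  generalize C U = u at *
  generalize catalanZ = c at *
  generalize w = w at *
  generalize z = z at *
  set S := 1 + 2 * u + (1 + u) * V * ((1 + u) * (c - 1) - u) with hS
  -- The equation multiplied by `(1 + u)^3 c^2`, with `w` and `z` eliminated; it is a multiple of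
  -- the Catalan equation for `V`.
  have hE : u * (c - 1) * ((S - (1 + u - u ^ 2)) * (S - c)) - (c - 1) * (1 + u) ^ 3 * (S - c)
      + u * c ^ 2 * (S - (1 + u - u ^ 2)) = 0 := by
    rw [hS]
    linear_combination -(1 + u) * ((1 + u) * (c - 1) - u) ^ 2 * hV
  linear_combination hE - (w * (1 + u) ^ 3 * hc + (c - 1) * hw) * ((S - (1 + u - u ^ 2)) * (S - c))
    + hc * (1 + u) ^ 3 * (S - c) - hw * c ^ 2 * (S - (1 + u - u ^ 2))

/-! ### Coefficient extraction. -/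

/-- The coefficients of `1 + U - U ^ 2` satisfy a hypergeometric recurrence. -/
theorem coeff_succ_one_add_sub_sq {U : PowerSeries ℚ} (hU : U = X * (1 + U) ^ 3) (n : ℕ)
    (hn : 1 ≤ n) :
    2 * ((n : ℚ) + 2) * (2 * n + 3) * coeff (n + 1) (1 + U - U ^ 2)
      = 3 * (3 * n + 2) * (3 * n + 1) * coeff n (1 + U - U ^ 2) := by
  set F := 1 + U - U ^ 2 with hF
  have hU0 : constantCoeff U = 0 := by
    rw [hU]; simp
  have hp : 1 + U ≠ 0 := fun h => by
    simpa [hU0] using congrArg constantCoeff h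
  have hq : 1 - 2 * U ≠ 0 := fun h => by
    simpa [hU0] using congrArg constantCoeff h
  -- The Euler operator multiplies the `k`-th coefficient by `k`, so a differential equation in `D`
  -- becomes a recurrence.
  set D : PowerSeries ℚ → PowerSeries ℚ := fun f => X * d⁄dX ℚ f with hDdef
  have hD : ∀ f k, coeff k (D f) = k * coeff k f := by
    intro f k
    cases k with
    | zero => simp [hDdef]
    | succ k =>
      simp only [hDdef]
      rw [coeff_succ_X_mul, coeff_derivative]
      push_cast
      ring
  have hDU : (1 - 2 * U) * D U = U * (1 + U) := by
    have h := congrArg (d⁄dX ℚ) hU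
    simp only [Derivation.leibniz, Derivation.leibniz_pow, derivative_X, map_add,
      Derivation.map_one_eq_zero, smul_eq_mul, nsmul_eq_mul, zero_add] at h
    simp only [hDdef]
    push_cast at h
    linear_combination (1 + U) * X * h - ((1 + U) + 3 * X * d⁄dX ℚ U) * hU
  have hDF : D F = U * (1 + U) := by
    apply mul_left_cancel₀ hq
    have : D F = (1 - 2 * U) * D U := by
      simp only [hDdef, hF, map_sub, map_add, Derivation.leibniz_pow,
        Derivation.map_one_eq_zero, smul_eq_mul, nsmul_eq_mul, zero_add]
      push_cast
      ring
    rw [this, hDU]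
  have hDDF : (1 - 2 * U) * D (D F) = (1 + 2 * U) * (U * (1 + U)) := by
    have : D (D F) = (1 + 2 * U) * D U := by
      rw [hDF]
      simp only [hDdef, map_add, Derivation.leibniz,
        Derivation.map_one_eq_zero, smul_eq_mul, zero_add]
      ring
    rw [this]
    linear_combination (1 + 2 * U) * hDU
  -- The polynomials in `D` are `2(D + 1)(2D + 1)` and `3(3D + 1)(3D + 2)`. The right side has
  -- degree 1, whence the restriction `1 ≤ n`.
  have hode : 4 * D (D F) + 6 * D F + 2 * F - X * (27 * D (D F) + 27 * D F + 6 * F)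
      = 2 + 6 * X := by
    apply mul_left_cancel₀ (mul_ne_zero hq (pow_ne_zero 3 hp))
    rw [hDF, hF]
    rw [hDF] at hDDF
    linear_combination (4 * (1 + U) ^ 3 - 27 * X * (1 + U) ^ 3) * hDDF +
      (27 * (1 + 2 * U) * (U * (1 + U)) +
        (1 - 2 * U) * (27 * (U * (1 + U)) + 6 * (1 + U - U ^ 2) + 6)) * hU
  have h := congrArg (coeff (n + 1)) hode
  have hc2 : coeff (n + 1) (2 : PowerSeries ℚ) = 0 := by
    rw [← map_ofNat (C (R := ℚ)) 2, coeff_C]; simp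
  have hc6 : coeff (n + 1) (6 * X : PowerSeries ℚ) = 0 := by
    rw [← map_ofNat (C (R := ℚ)) 6, coeff_C_mul, coeff_X, if_neg (by omega), mul_zero]
  have hnum : ∀ (a : ℕ) [a.AtLeastTwo] (f : PowerSeries ℚ) k,
      coeff k (OfNat.ofNat a * f) = OfNat.ofNat a * coeff k f := by
    intro a _ f k
    rw [← map_ofNat (C (R := ℚ)) a, coeff_C_mul]
  rw [map_add, hc2, hc6] at h
  simp only [map_add, map_sub, coeff_succ_X_mul, hnum, hD] at h
  push_cast at h
  linear_combination h

theorem choose_three_mul_succ (n : ℕ) :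
    (3 * (n + 1)).choose (n + 1) * (2 * (n + 1) * (2 * n + 1))
      = 3 * (3 * n + 2) * (3 * n + 1) * (3 * n).choose n := by
  have h1 := Nat.choose_mul_factorial_mul_factorial (show n ≤ 3 * n by omega)
  have h2 := Nat.choose_mul_factorial_mul_factorial (show n + 1 ≤ 3 * (n + 1) by omega)
  rw [show 3 * n - n = 2 * n by omega] at h1
  rw [show 3 * (n + 1) - (n + 1) = 2 * n + 1 + 1 by omega] at h2
  rw [show (3 * (n + 1)).factorial = (3 * n + 1 + 1 + 1).factorial by ring_nf] at h2
  simp only [Nat.factorial_succ] at h2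
  rw [← h1] at h2
  have h0 : 0 < (n + 1) * (n.factorial * (2 * n).factorial) := by positivity
  apply Nat.eq_of_mul_eq_mul_left h0
  linear_combination h2

theorem coeff_one_add_sub_sq {U : PowerSeries ℚ} (hU : U = X * (1 + U) ^ 3) (n : ℕ)
    (hn : 1 ≤ n) :
    coeff n (1 + U - U ^ 2)
      = 2 / (((n : ℚ) + 1) * (2 * (n : ℚ) + 1)) * ((3 * n).choose n : ℚ) := by
  induction n, hn using Nat.le_induction with
  | base =>
    have hU0 : constantCoeff U = 0 := by
      rw [hU]; simp
    have h1 : coeff 1 U = 1 := by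
      rw [hU, ← zero_add 1, coeff_succ_X_mul, coeff_zero_eq_constantCoeff_apply]
      simp [hU0]
    rw [map_sub, map_add, sq, coeff_mul, Finset.Nat.antidiagonal_succ]
    simp [h1, hU0, coeff_one]
    norm_num
  | succ n hn ih =>
    have h := coeff_succ_one_add_sub_sq hU n hn
    rw [ih] at h
    have hch : (((3 * (n + 1)).choose (n + 1) : ℕ) : ℚ) * (2 * (n + 1) * (2 * n + 1))
        = 3 * (3 * n + 2) * (3 * n + 1) * ((3 * n).choose n : ℕ) :=
      mod_cast choose_three_mul_succ n
    have h2 : 2 * ((n : ℚ) + 2) * (2 * n + 3) ≠ 0 := by positivity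
    apply mul_left_cancel₀ h2
    rw [h]
    push_cast
    rw [eq_div_of_mul_eq (by positivity) hch]
    field_simp
    ring

end StackSort

theorem mainTheorem9 :
    -- the formula for the number of 2-stack-sortable permutations
    (∀ n : ℕ, 1 ≤ n →
      (StackSort.W 2 n : ℚ)
        = 2 / (((n : ℚ) + 1) * (2 * (n : ℚ) + 1)) * ((3 * n).choose n : ℚ)) ∧
    -- the functional equation for `I(w, z)`, multiplied by `w z`
    (StackSort.w * StackSort.z *
        ((StackSort.I - PowerSeries.C StackSort.I0) * (StackSort.I - StackSort.catalanZ))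
      = StackSort.z * (StackSort.I - StackSort.catalanZ)
        - StackSort.w * (StackSort.I - PowerSeries.C StackSort.I0)) ∧
    -- `I(w, 0)` is the generating function of the numbers `W_2(n)`
    StackSort.I0 = PowerSeries.mk (fun n => (StackSort.W 2 n : ℚ)) ∧
    -- `U = w (1 + U)^3` defines a unique power series, and `I(w, 0) = 1 + U - U^2`
    (∃! U : PowerSeries ℚ, U = PowerSeries.X * (1 + U) ^ 3) ∧
    (∀ U : PowerSeries ℚ, U = PowerSeries.X * (1 + U) ^ 3 →
      StackSort.I0 = 1 + U - U ^ 2) := by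
  have hI0 : StackSort.I0 = PowerSeries.mk (fun n => (StackSort.W 2 n : ℚ)) := by
    ext n
    simp [StackSort.I0, StackSort.I, StackSort.G, StackSort.BGe_zero]
  have hsol : ∀ U : PowerSeries ℚ, U = PowerSeries.X * (1 + U) ^ 3 →
      StackSort.I0 = 1 + U - U ^ 2 := by
    intro U hU
    rw [StackSort.I0, StackSort.eq_of_functional_equation StackSort.I_functional_equation
      (StackSort.solution_functional_equation hU), StackSort.constantCoeff_solution]
  refine ⟨fun n hn => ?_, StackSort.I_functional_equation, hI0,
    StackSort.existsUnique_eq_X_mul_one_add_cube, hsol⟩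
  obtain ⟨U, hU⟩ := StackSort.exists_eq_X_mul_one_add_cube
  rw [← StackSort.coeff_one_add_sub_sq hU n hn, ← hsol U hU, hI0, PowerSeries.coeff_mk]
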